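/- All graphs are finite, simple and undirected. For a graph $H$ and an integer $k\ge 1$, the Token Jumping graph $\mathsf{TJ}_k(H)$ has as vertices the $k$-cliques of $H$ (sets of $k$ pairwise adjacent vertices), two of them, $A$ and $B$, being adjacent when $|A\cap B|=k-1$. For a graph $G$ let $$\mathcal{K}^{\mathsf{TJ}}(G)=\{k\ge 1:\ \mathsf{TJ}_k(H)\cong G\text{ for some graph }H\}.$$ Write $\overline{G}$ for the complement of $G$; $K_n$, $P_n$ and $C_n$ for the complete graph, the path and the cycle on $n$ vertices; $K_{m,n}$ for the complete bipartite graph with classes of sizes $m$ and $n$; $B_p$ ($p\ge 1$) for the book graph, consisting of $p$ triangles sharing a common edge; and $F_p$ ($p\ge 1$) for the friendship graph, consisting of $p$ triangles sharing a common vertex. **Theorem.** The following hold. 1. $\mathcal{K}^{\mathsf{TJ}}(\overline{K_n})=\{k:k\ge 2\}$ for every $n\ge 2$. 2. $\mathcal{K}^{\mathsf{TJ}}(\overline{K_{1,n}})=\{k:k\ge 2\}$ for every $n\ge 1$. 3. $\mathcal{K}^{\mathsf{TJ}}(\overline{K_{m,n}})=\{k:k\ge 2\}$ whenever $2\le m\le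 n$. 4. $\mathcal{K}^{\mathsf{TJ}}(\overline{B_p})=\{k:k\ge 2\}$ for every $p\ge 1$. 5. $\mathcal{K}^{\mathsf{TJ}}(\overline{P_n})=\{k:k\ge 2\}$ for $3\le n\le 5$, and $\mathcal{K}^{\mathsf{TJ}}(\overline{P_n})=\varnothing$ for every $n\ge 6$. 6. $\mathcal{K}^{\mathsf{TJ}}(\overline{C_n})=\{k:k\ge 2\}$ for $4\le n\le 6$, and $\mathcal{K}^{\mathsf{TJ}}(\overline{C_n})=\varnothing$ for every $n\ge 7$. 7. $\mathcal{K}^{\mathsf{TJ}}(\overline{F_p})=\{k:k\ge 2\}$ for $1\le p\le 2$, $\mathcal{K}^{\mathsf{TJ}}(\overline{F_3})=\{2\}$, and $\mathcal{K}^{\mathsf{TJ}}(\overline{F_p})=\varnothing$ for every $p\ge 4$. -/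

import Mathlib

/-- The Token Jumping reconfiguration graph `TJ_k(H)`: its vertices are the `k`-cliques of `H`, and
`A`, `B` are adjacent when `|A ∩ B| = k - 1`. The equation is written without subtraction; in the
range `k ≥ 1`, the only one that is used, this is the same condition. -/
def tokenJumpingGraph {W : Type*} [DecidableEq W] (H : SimpleGraph W) (k : ℕ) :
    SimpleGraph {A : Finset W // H.IsNClique k A} where
  Adj A B := (A.1 ∩ B.1).card + 1 = k
  symm := ⟨fun A B h => by rwa [Finset.inter_comm]⟩
  loopless := ⟨fun A h => by
    have h2 := A.2.card_eq
    rw [Finset.inter_self] at h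
    omega⟩

/-- The Token Jumping feasibility set of `G`: all `k ≥ 1` such that `TJ_k(H) ≅ G` for some finite
simple graph `H`. -/
def feasibleTJ {V : Type*} (G : SimpleGraph V) : Set ℕ :=
  {k | 1 ≤ k ∧ ∃ (W : Type) (_ : Fintype W) (_ : DecidableEq W) (H : SimpleGraph W),
    Nonempty (tokenJumpingGraph H k ≃g G)}

/-- The book graph `B_p`: `p` triangles that share a common edge. The common edge joins the two
vertices `Sum.inl 0` and `Sum.inl 1`, and the third vertex of the `i`-th triangle is `Sum.inr i`. -/
def bookGraph (p : ℕ) : SimpleGraph (Fin 2 ⊕ Fin p) where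
  Adj x y := x ≠ y ∧ (x.isLeft ∨ y.isLeft)
  symm := ⟨fun _ _ h => ⟨h.1.symm, h.2.symm⟩⟩
  loopless := ⟨fun _ h => h.1 rfl⟩

/-- The friendship graph `F_p`: `p` triangles that share a common vertex. The common vertex is
`none`, and the other two vertices of the `i`-th triangle are `some (i, 0)` and `some (i, 1)`. -/
def friendshipGraph (p : ℕ) : SimpleGraph (Option (Fin p × Fin 2)) where
  Adj x y := x ≠ y ∧ (x = none ∨ y = none ∨ x.map Prod.fst = y.map Prod.fst)
  symm := ⟨fun _ _ h => ⟨h.1.symm, by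
    rcases h.2 with h | h | h
    · exact Or.inr (Or.inl h)
    · exact Or.inl h
    · exact Or.inr (Or.inr h.symm)⟩⟩
  loopless := ⟨fun _ h => h.1 rfl⟩

open Finset

/-! `TJ_k(H)` is an induced subgraph of the Johnson graph on `k`-sets. There, the common neighbours
of two distinct non-adjacent vertices lie in a 2×2 rook grid, a 4-cycle, so any three of them induce
a path on three vertices. Three common neighbours inducing another graph thus rule out every `k`
(`feasibleTJ_eq_empty`). Conversely, `TJ_2` of a triangle-free graph is its line graph, and joining
that graph with `K_{k-2}` gives the same result for each `k ≥ 2` (`mem_feasibleTJ_of_edges`). The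
remaining feasible complements are such line graphs, except for `F_3`: it needs `K_4`, whose
triangles spoil `k ≥ 3`, and `le_two_of_mem_feasibleTJ` excludes those `k`. -/

/-- A feasible parameter presents the vertices of `G` as the `k`-cliques of a graph. -/
theorem exists_cliques_of_mem_feasibleTJ {V : Type*} {G : SimpleGraph V} {k : ℕ}
    (hk : k ∈ feasibleTJ G) :
    ∃ (W : Type) (_ : DecidableEq W) (H : SimpleGraph W) (S : V → Finset W),
      (∀ v, H.IsNClique k (S v)) ∧ Function.Injective S ∧
      (∀ T, H.IsNClique k T → ∃ v, S v = T) ∧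
      ∀ u v, G.Adj u v ↔ #(S u ∩ S v) + 1 = k := by
  obtain ⟨-, W, _, hW, H, ⟨e⟩⟩ := hk
  refine ⟨W, hW, H, fun v => (e.symm v).1, fun v => (e.symm v).2, fun u v h => ?_,
    fun T hT => ⟨e ⟨T, hT⟩, by simp⟩, fun u v => ?_⟩
  · exact e.symm.injective (Subtype.ext h)
  · exact (e.symm.map_adj_iff (v := u) (w := v)).symm

/-- Any two distinct singletons meet in `0 = k - 1` elements, so `TJ_1` is always complete. -/
theorem two_le_of_mem_feasibleTJ {V : Type*} {G : SimpleGraph V} {k : ℕ}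
    (hk : k ∈ feasibleTJ G) {u v : V} (huv : u ≠ v) (hG : ¬ G.Adj u v) : 2 ≤ k := by
  have h1 : 1 ≤ k := hk.1
  obtain ⟨W, _, H, S, hS, hinj, -, hadj⟩ := exists_cliques_of_mem_feasibleTJ hk
  by_contra h2
  obtain rfl : k = 1 := by omega
  obtain ⟨a, ha⟩ := card_eq_one.1 (hS u).card_eq
  obtain ⟨b, hb⟩ := card_eq_one.1 (hS v).card_eq
  have hab : a ≠ b := by
    rintro rfl
    exact huv (hinj (ha.trans hb.symm))
  apply hG
  rw [hadj, ha, hb, singleton_inter_of_notMem (by simpa using hab)]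
  rfl

/-! ### Common neighbours in the Johnson graph -/

section JohnsonGraph

variable {W : Type*} [DecidableEq W] {k : ℕ} {A B : Finset W}

/-- In the Johnson graph, the common neighbours of two non-adjacent vertices `A` and `B` consist of
`A ∩ B`, one element of `A \ B` and one element of `B \ A`. -/
theorem johnson_common_neighbor (hA : #A = k) (hB : #B = k) (hne : A ≠ B)
    (hAB : #(A ∩ B) + 1 ≠ k) {X : Finset W} (hX : #X = k) (hXA : #(A ∩ X) + 1 = k)
    (hXB : #(B ∩ X) + 1 = k) :
    #(A ∩ B) + 2 = k ∧ ∃ x ∈ A \ B, ∃ y ∈ B \ A, X = insert x (insert y (A ∩ B)) := by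
  have hlt : #(A ∩ B) < k := by
    rw [← hA]
    refine card_lt_card ⟨inter_subset_left, fun h => hne ?_⟩
    exact eq_of_subset_of_card_le (fun a ha => (mem_inter.1 (h ha)).2) (by omega)
  have h1 := card_union_add_card_inter (A ∩ X) (B ∩ X)
  have h2 : #(A ∩ X ∪ B ∩ X) ≤ k := hX ▸ card_le_card (union_subset inter_subset_right
    inter_subset_right)
  have h3 : #((A ∩ X) ∩ (B ∩ X)) ≤ #(A ∩ B) := card_le_card (inter_subset_inter
    inter_subset_left inter_subset_left)
  -- Two `(k-1)`-subsets of `X` share at least `k - 2` elements, while non-adjacency gives `#(A ∩ B)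
  -- ≤ k - 2`.
  have h4 : #(A ∩ B) + 2 = k := by omega
  have hSX : A ∩ B ⊆ X := by
    rw [← eq_of_subset_of_card_le (inter_subset_inter inter_subset_left inter_subset_left)
      (show #(A ∩ B) ≤ #((A ∩ X) ∩ (B ∩ X)) by omega)]
    exact inter_subset_left.trans inter_subset_right
  have hx : ∃ x ∈ A ∩ X, x ∉ A ∩ B := by
    by_contra! h
    have := card_le_card h
    omega
  have hy : ∃ y ∈ B ∩ X, y ∉ A ∩ B := by
    by_contra! h
    have := card_le_card h
    omega
  obtain ⟨x, hx, hx'⟩ := hx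
  obtain ⟨y, hy, hy'⟩ := hy
  simp only [mem_inter, not_and] at hx hx' hy hy'
  have hxB := hx' hx.1
  have hyA : y ∉ A := fun h => hy' h hy.1
  have hxy : x ≠ y := by rintro rfl; exact hyA hx.1
  refine ⟨h4, x, by simp [hx.1, hxB], y, by simp [hy.1, hyA], ?_⟩
  refine (eq_of_subset_of_card_le ?_ ?_).symm
  · intro z hz
    simp only [mem_insert] at hz
    rcases hz with rfl | rfl | hz
    exacts [hx.2, hy.2, hSX hz]
  · rw [card_insert_of_notMem (by simp [hxy, hxB]), card_insert_of_notMem (by simp [hyA])]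
    omega

/-- The pairs in `(A \ B) × (B \ A)` are coordinates of the common neighbours; adjacency is a rook
move. -/
theorem johnson_grid_adj (hk : #(A ∩ B) + 2 = k) {x x' y y' : W} (hx : x ∈ A \ B)
    (hx' : x' ∈ A \ B) (hy : y ∈ B \ A) (hy' : y' ∈ B \ A) :
    #(insert x (insert y (A ∩ B)) ∩ insert x' (insert y' (A ∩ B))) + 1 = k ↔
      (x = x' ∧ y ≠ y') ∨ (x ≠ x' ∧ y = y') := by
  simp only [mem_sdiff] at hx hx' hy hy'
  have hxy : ∀ {u v}, u ∈ A ∧ u ∉ B → v ∈ B ∧ v ∉ A → u ≠ v := by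
    rintro u v hu hv rfl
    exact hu.2 hv.1
  by_cases h1 : x = x' <;> by_cases h2 : y = y'
  · subst h1 h2
    rw [inter_self, card_insert_of_notMem (by simp [hxy hx hy, hx.2]),
      card_insert_of_notMem (by simp [hy.2])]
    simp
    omega
  · subst h1
    have : insert x (insert y (A ∩ B)) ∩ insert x (insert y' (A ∩ B)) = insert x (A ∩ B) := by
      ext z; simp only [mem_inter, mem_insert]; grind
    rw [this, card_insert_of_notMem (by simp [hx.2])]
    simp [h2]
    omega
  · subst h2
    have : insert x (insert y (A ∩ B)) ∩ insert x' (insert y (A ∩ B)) = insert y (A ∩ B) := by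
      ext z; simp only [mem_inter, mem_insert]; grind
    rw [this, card_insert_of_notMem (by simp [hy.2])]
    simp [h1]
    omega
  · have : insert x (insert y (A ∩ B)) ∩ insert x' (insert y' (A ∩ B)) = A ∩ B := by
      ext z; simp only [mem_inter, mem_insert]; grind
    rw [this]
    simp [h1, h2]
    omega

/-- If `A ∩ B + x + y` and `A ∩ B + x' + y'` are adjacent, any two elements of their union lie in
one of them, in `A`, or in `B`. -/
theorem johnson_grid_cover {x x' y y' : W} (hx : x ∈ A \ B) (hx' : x' ∈ A \ B) (hy : y ∈ B \ A)
    (hy' : y' ∈ B \ A) (h : x = x' ∨ y = y') {u v : W}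
    (hu : u ∈ insert x (insert y (A ∩ B)) ∪ insert x' (insert y' (A ∩ B)))
    (hv : v ∈ insert x (insert y (A ∩ B)) ∪ insert x' (insert y' (A ∩ B))) :
    (u ∈ insert x (insert y (A ∩ B)) ∧ v ∈ insert x (insert y (A ∩ B))) ∨
      (u ∈ insert x' (insert y' (A ∩ B)) ∧ v ∈ insert x' (insert y' (A ∩ B))) ∨
      (u ∈ A ∧ v ∈ A) ∨ (u ∈ B ∧ v ∈ B) := by
  simp only [mem_sdiff, mem_union, mem_insert, mem_inter] at *
  rcases h with rfl | rfl <;> rcases hu with (rfl | rfl | hu) | (rfl | rfl | hu) <;>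
    rcases hv with (rfl | rfl | hv) | (rfl | rfl | hv) <;> simp_all

/-- Among three elements of a set of size two, two coincide. -/
theorem eq_or_eq_or_eq_of_card_eq_two {s : Finset W} (hs : #s = 2) {x y z : W} (hx : x ∈ s)
    (hy : y ∈ s) (hz : z ∈ s) : x = y ∨ y = z ∨ x = z := by
  obtain ⟨a, b, -, rfl⟩ := card_eq_two.1 hs
  simp only [mem_insert, mem_singleton] at hx hy hz
  grind

/-- Three common neighbours of two non-adjacent vertices of the Johnson graph induce a path. -/
theorem johnson_three_common_neighbors (hA : #A = k) (hB : #B = k) (hne : A ≠ B)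
    (hAB : #(A ∩ B) + 1 ≠ k) {X Y Z : Finset W} (hX : #X = k) (hY : #Y = k) (hZ : #Z = k)
    (hXA : #(A ∩ X) + 1 = k) (hXB : #(B ∩ X) + 1 = k)
    (hYA : #(A ∩ Y) + 1 = k) (hYB : #(B ∩ Y) + 1 = k)
    (hZA : #(A ∩ Z) + 1 = k) (hZB : #(B ∩ Z) + 1 = k)
    (hXY : X ≠ Y) (hYZ : Y ≠ Z) (hXZ : #(X ∩ Z) + 1 = k) :
    ¬ (#(X ∩ Y) + 1 = k ↔ #(Y ∩ Z) + 1 = k) := by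
  obtain ⟨hk, x, hx, x', hx', rfl⟩ := johnson_common_neighbor hA hB hne hAB hX hXA hXB
  obtain ⟨-, y, hy, y', hy', rfl⟩ := johnson_common_neighbor hA hB hne hAB hY hYA hYB
  obtain ⟨-, z, hz, z', hz', rfl⟩ := johnson_common_neighbor hA hB hne hAB hZ hZA hZB
  have c1 : #(A \ B) = 2 := by have := card_sdiff_add_card_inter A B; omega
  have c2 : #(B \ A) = 2 := by
    have := card_sdiff_add_card_inter B A
    rw [inter_comm] at this
    omega
  have d1 := eq_or_eq_or_eq_of_card_eq_two c1 hx hy hz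
  have d2 := eq_or_eq_or_eq_of_card_eq_two c2 hx' hy' hz'
  rw [johnson_grid_adj hk hx hz hx' hz'] at hXZ
  rw [johnson_grid_adj hk hx hy hx' hy', johnson_grid_adj hk hy hz hy' hz']
  have e1 : ¬ (x = y ∧ x' = y') := by rintro ⟨rfl, rfl⟩; exact hXY rfl
  have e2 : ¬ (y = z ∧ y' = z') := by rintro ⟨rfl, rfl⟩; exact hYZ rfl
  -- `X` and `Z` fill a row or column of the 2×2 grid; `Y` lies in the opposite one, so it is
  -- adjacent to exactly one of them.
  grind

end JohnsonGraph

/-! ### Obstructions to feasibility -/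

/-- If two non-adjacent vertices of `G` have three common neighbours that do not induce a path,
then `G` is not a Token Jumping graph. -/
theorem feasibleTJ_eq_empty {V : Type*} {G : SimpleGraph V} {a b x y z : V} (hne : a ≠ b)
    (hab : ¬ G.Adj a b) (hax : G.Adj a x) (hbx : G.Adj b x) (hay : G.Adj a y) (hby : G.Adj b y)
    (haz : G.Adj a z) (hbz : G.Adj b z) (hxy : x ≠ y) (hyz : y ≠ z) (hxz : G.Adj x z)
    (h : G.Adj x y ↔ G.Adj y z) : feasibleTJ G = ∅ := by
  refine Set.eq_empty_of_forall_notMem fun k hk => ?_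
  obtain ⟨W, _, H, S, hS, hinj, -, hadj⟩ := exists_cliques_of_mem_feasibleTJ hk
  simp only [hadj] at *
  exact johnson_three_common_neighbors (hS a).card_eq (hS b).card_eq (hinj.ne hne) hab
    (hS x).card_eq (hS y).card_eq (hS z).card_eq hax hbx hay hby haz hbz (hinj.ne hxy)
    (hinj.ne hyz) hxz h

/-- Let `a`, `b` be non-adjacent vertices with adjacent common neighbours `x`, `y`. If every neighbour
of `x` is `a`, `b` or a common neighbour of both, then no `k ≥ 3` is feasible. -/
theorem le_two_of_mem_feasibleTJ {V : Type*} {G : SimpleGraph V} {k : ℕ} (hk : k ∈ feasibleTJ G)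
    {a b x y : V} (hne : a ≠ b) (hab : ¬ G.Adj a b) (hax : G.Adj a x) (hbx : G.Adj b x)
    (hay : G.Adj a y) (hby : G.Adj b y) (hxy : G.Adj x y)
    (h : ∀ v, G.Adj x v → v = a ∨ v = b ∨ (G.Adj a v ∧ G.Adj b v)) : k ≤ 2 := by
  obtain ⟨W, _, H, S, hS, hinj, hsurj, hadj⟩ := exists_cliques_of_mem_feasibleTJ hk
  by_contra! hk2
  simp only [hadj] at hab hax hbx hay hby hxy h
  have key := fun {v} => johnson_common_neighbor (hS a).card_eq (hS b).card_eq (hinj.ne hne) hab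
    (hS v).card_eq
  obtain ⟨hk', p, hp, q, hq, hX⟩ := key hax hbx
  obtain ⟨-, p', hp', q', hq', hY⟩ := key hay hby
  have hpq : (p = p' ∧ q ≠ q') ∨ (p ≠ p' ∧ q = q') := by
    rwa [hX, hY, johnson_grid_adj hk' hp hp' hq hq'] at hxy
  -- Here `k ≥ 3` enters: `#(S a ∩ S b) = k - 2 > 0`. The token `s` lies in every clique allowed as
  -- a neighbour of `x`.
  obtain ⟨s, hs⟩ : (S a ∩ S b).Nonempty := card_pos.1 (by omega)
  have hmem : ∀ v, (v = a ∨ v = b ∨ (#(S a ∩ S v) + 1 = k ∧ #(S b ∩ S v) + 1 = k)) → s ∈ S v := by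
    rintro v (rfl | rfl | ⟨h1, h2⟩)
    · exact (mem_inter.1 hs).1
    · exact (mem_inter.1 hs).2
    · obtain ⟨-, _, -, _, -, hv⟩ := key h1 h2
      rw [hv]
      simp only [mem_insert]
      exact Or.inr (Or.inr hs)
  have hsx : s ∈ S x := hmem x (Or.inr (Or.inr ⟨hax, hbx⟩))
  have hcard : #(S x ∪ S y) = k + 1 := by
    have := card_union_add_card_inter (S x) (S y)
    rw [(hS x).card_eq, (hS y).card_eq] at this
    omega
  -- This clique is a neighbour of `x` that omits `s`, which is the contradiction. Any two of its
  -- elements lie together in one of the cliques of `x`, `y`, `a`, `b`.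
  have hT : H.IsNClique k ((S x ∪ S y).erase s) := by
    refine ⟨?_, by rw [card_erase_of_mem (mem_union_left _ hsx), hcard]; rfl⟩
    have hcov : ∀ u ∈ S x ∪ S y, ∀ v ∈ S x ∪ S y, ∃ w, u ∈ S w ∧ v ∈ S w := by
      intro u hu v hv
      rw [hX, hY] at hu hv
      rcases johnson_grid_cover hp hp' hq hq' (hpq.imp And.left And.right) hu hv with h | h | h | h
      · exact ⟨x, by rwa [hX]⟩
      · exact ⟨y, by rwa [hY]⟩
      · exact ⟨a, h⟩
      · exact ⟨b, h⟩
    intro u hu v hv huv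
    obtain ⟨w, hw⟩ := hcov u (mem_of_mem_erase hu) v (mem_of_mem_erase hv)
    exact (hS w).isClique hw.1 hw.2 huv
  obtain ⟨v, hv⟩ := hsurj _ hT
  have hxv : #(S x ∩ S v) + 1 = k := by
    have : S x ∩ S v = (S x).erase s := by
      rw [hv]; ext z; simp only [mem_inter, mem_erase, mem_union]; tauto
    rw [this, card_erase_of_mem hsx, (hS x).card_eq]
    omega
  have := hmem v (h v hxv)
  rw [hv] at this
  exact notMem_erase _ _ this

/-! ### Line graphs as Token Jumping graphs -/

section Constructions

/-- The join of the graph with edges `f v` with a complete graph on `m` vertices. -/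
def joinGraph {V W : Type*} (f : V → Finset W) (m : ℕ) : SimpleGraph (W ⊕ Fin m) where
  Adj s t := s ≠ t ∧ ∀ x y, s = Sum.inl x → t = Sum.inl y → ∃ v, x ∈ f v ∧ y ∈ f v
  symm := ⟨fun _ _ h => ⟨h.1.symm, fun x y hx hy => by
    obtain ⟨v, hv⟩ := h.2 y x hy hx
    exact ⟨v, hv.symm⟩⟩⟩
  loopless := ⟨fun _ h => h.1 rfl⟩

/-- If `G` is the line graph of a triangle-free graph with edges `f v`, then every `k ≥ 2` is
feasible for `G`. For `k = 2`, triangles are allowed. -/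
theorem mem_feasibleTJ_of_edges {V W : Type} [Fintype W] [DecidableEq W] {G : SimpleGraph V}
    (f : V → Finset W) (hcard : ∀ v, #(f v) = 2) (hinj : Function.Injective f)
    (hadj : ∀ u v, G.Adj u v ↔ #(f u ∩ f v) = 1) {k : ℕ} (hk : 2 ≤ k)
    (htri : 2 < k → ∀ u v w, G.Adj u v → G.Adj v w → G.Adj u w → (f u ∩ f v ∩ f w).Nonempty) :
    k ∈ feasibleTJ G := by
  obtain ⟨m, rfl⟩ := Nat.exists_eq_add_of_le' hk
  refine ⟨by omega, W ⊕ Fin m, inferInstance, inferInstance, joinGraph f m, ⟨RelIso.symm ?_⟩⟩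
  have hclique : ∀ v, (joinGraph f m).IsNClique (m + 2) ((f v).disjSum univ) := by
    refine fun v => ⟨fun s hs t ht hst => ⟨hst, ?_⟩, by simp [card_disjSum, hcard, add_comm]⟩
    rintro x y rfl rfl
    exact ⟨v, by simpa using hs, by simpa using ht⟩
  have heq : ∀ {v x y}, x ≠ y → x ∈ f v → y ∈ f v → f v = {x, y} := by
    intro v x y hxy hx hy
    refine (eq_of_subset_of_card_le ?_ (by rw [hcard, card_pair hxy])).symm
    simp [insert_subset_iff, hx, hy]
  refine ⟨Equiv.ofBijective (fun v => ⟨(f v).disjSum univ, hclique v⟩) ⟨fun u v h => ?_, ?_⟩, ?_⟩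
  · apply hinj
    have h' := congrArg (fun A => A.1.toLeft) h
    simpa using h'
  · rintro ⟨A, hA⟩
    have hsum : #A.toLeft + #A.toRight = m + 2 := by rw [card_toLeft_add_card_toRight, hA.card_eq]
    have hright : #A.toRight ≤ m := by simpa using card_le_univ A.toRight
    have hpair : ∀ x ∈ A.toLeft, ∀ y ∈ A.toLeft, x ≠ y → ∃ v, f v = {x, y} := by
      intro x hx y hy hxy
      obtain ⟨v, hv⟩ := (hA.isClique (mem_toLeft.1 hx) (mem_toLeft.1 hy)
        (by simpa using hxy)).2 x y rfl rfl
      exact ⟨v, heq hxy hv.1 hv.2⟩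
    -- At most `m` vertices come from `Fin m`, so at least two come from `W`. Three would span a
    -- triangle, whose edges have no common vertex; for `m = 0` the size of `A` already excludes
    -- this.
    have hleft : #A.toLeft = 2 := by
      by_contra hne
      have hm : 2 < m + 2 := by omega
      obtain ⟨x, hx, y, hy, z, hz, hxy, hxz, hyz⟩ :=
        two_lt_card.1 (show 2 < #A.toLeft by omega)
      obtain ⟨u, hu⟩ := hpair x hx y hy hxy
      obtain ⟨v, hv⟩ := hpair y hy z hz hyz
      obtain ⟨w, hw⟩ := hpair x hx z hz hxz
      have huv : G.Adj u v := by
        rw [hadj, hu, hv, card_eq_one]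
        exact ⟨y, by ext t; simp only [mem_inter, mem_insert, mem_singleton]; grind⟩
      have hvw : G.Adj v w := by
        rw [hadj, hv, hw, card_eq_one]
        exact ⟨z, by ext t; simp only [mem_inter, mem_insert, mem_singleton]; grind⟩
      have huw : G.Adj u w := by
        rw [hadj, hu, hw, card_eq_one]
        exact ⟨x, by ext t; simp only [mem_inter, mem_insert, mem_singleton]; grind⟩
      obtain ⟨t, ht⟩ := htri hm u v w huv hvw huw
      rw [hu, hv, hw] at ht
      simp only [mem_inter, mem_insert, mem_singleton] at ht
      grind
    have huniv : A.toRight = univ := by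
      rw [← card_eq_iff_eq_univ, Fintype.card_fin]
      omega
    obtain ⟨x, y, hxy, hA'⟩ := card_eq_two.1 hleft
    obtain ⟨v, hv⟩ := hpair x (by simp [hA']) y (by simp [hA']) hxy
    refine ⟨v, Subtype.ext ?_⟩
    change (f v).disjSum univ = A
    rw [hv, ← hA', ← huniv, toLeft_disjSum_toRight]
  · intro u v
    rw [hadj]
    change #((f u).disjSum univ ∩ (f v).disjSum univ) + 1 = m + 2 ↔ _
    have : (f u).disjSum univ ∩ (f v).disjSum univ = (f u ∩ f v).disjSum (univ : Finset (Fin m)) := by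
      ext (t | t) <;> simp
    rw [this, card_disjSum, card_univ, Fintype.card_fin]
    omega

/-- `htri` expresses triangle-freeness: three pairwise meeting edges form a star. -/
theorem feasibleTJ_eq_of_edges {V W : Type} [Fintype W] [DecidableEq W] {G : SimpleGraph V}
    (f : V → Finset W) (hcard : ∀ v, #(f v) = 2) (hinj : Function.Injective f)
    (hadj : ∀ u v, G.Adj u v ↔ #(f u ∩ f v) = 1)
    (htri : ∀ u v w, #(f u ∩ f v) = 1 → #(f v ∩ f w) = 1 → #(f u ∩ f w) = 1 →
      (f u ∩ f v ∩ f w).Nonempty)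
    {a b : V} (hab : a ≠ b) (hG : ¬ G.Adj a b) : feasibleTJ G = {k | 2 ≤ k} := by
  ext k
  refine ⟨fun hk => two_le_of_mem_feasibleTJ hk hab hG, fun hk => ?_⟩
  refine mem_feasibleTJ_of_edges f hcard hinj hadj hk fun _ u v w => ?_
  simpa only [hadj] using htri u v w

/-- Every `k ≥ 2` is feasible for a disjoint union of at least two complete graphs. -/
theorem feasibleTJ_eq_of_union_of_cliques {V I : Type} [Fintype V] [DecidableEq V] [Fintype I]
    [DecidableEq I] {G : SimpleGraph V} (c : V → I) (hadj : ∀ u v, G.Adj u v ↔ u ≠ v ∧ c u = c v)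
    {a b : V} (hab : c a ≠ c b) : feasibleTJ G = {k | 2 ≤ k} := by
  -- The model is a disjoint union of stars, one per class, with centre `Sum.inl (c u)` and leaves
  -- `Sum.inr u`.
  have hadj' : ∀ u v, #(({Sum.inl (c u), Sum.inr u} : Finset (I ⊕ V)) ∩
      {Sum.inl (c v), Sum.inr v}) = 1 ↔ u ≠ v ∧ c u = c v := by
    intro u v
    by_cases h : u = v
    · subst h; simp
    by_cases h' : c u = c v
    · simp only [h, h', ne_eq, not_false_eq_true, and_self, iff_true, card_eq_one]
      refine ⟨Sum.inl (c v), ?_⟩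
      ext (t | t) <;> simp
      rintro rfl; exact h
    · simp only [h', and_false, iff_false]
      have : (({Sum.inl (c u), Sum.inr u} : Finset (I ⊕ V)) ∩
          {Sum.inl (c v), Sum.inr v}) = ∅ := by
        ext (t | t) <;> simp <;> (rintro rfl; assumption)
      simp [this]
  refine feasibleTJ_eq_of_edges (fun v => ({Sum.inl (c v), Sum.inr v} : Finset (I ⊕ V)))
    (fun v => by simp) (fun u v h => ?_) (fun u v => by rw [hadj, hadj']) ?_
    (a := a) (b := b) (fun h => hab (by rw [h])) (fun h => hab ((hadj a b).1 h).2)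
  · have : Sum.inr u ∈ ({Sum.inl (c v), Sum.inr v} : Finset (I ⊕ V)) := by
      have h' : ({Sum.inl (c u), Sum.inr u} : Finset (I ⊕ V)) = {Sum.inl (c v), Sum.inr v} := h
      rw [← h']; simp
    simpa using this
  · intro u v w huv hvw _
    exact ⟨Sum.inl (c v), by simp [((hadj' u v).1 huv).2, ((hadj' v w).1 hvw).2]⟩

end Constructions

/-! ### The families of the theorem -/

theorem feasibleTJ_compl_completeGraph {n : ℕ} (hn : 2 ≤ n) :
    feasibleTJ (SimpleGraph.completeGraph (Fin n))ᶜ = {k | 2 ≤ k} :=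
  feasibleTJ_eq_of_union_of_cliques id (fun u v => by simp)
    (a := ⟨0, by omega⟩) (b := ⟨1, by omega⟩) (by simp)

theorem feasibleTJ_compl_completeBipartiteGraph {m n : ℕ} (hm : 1 ≤ m) (hn : 1 ≤ n) :
    feasibleTJ (completeBipartiteGraph (Fin m) (Fin n))ᶜ = {k | 2 ≤ k} :=
  feasibleTJ_eq_of_union_of_cliques Sum.isLeft (by rintro (u | u) (v | v) <;> simp)
    (a := Sum.inl ⟨0, hm⟩) (b := Sum.inr ⟨0, hn⟩) (by simp)

theorem feasibleTJ_compl_bookGraph (p : ℕ) : feasibleTJ (bookGraph p)ᶜ = {k | 2 ≤ k} :=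
  -- The two spine vertices become isolated; all others share the class `none`.
  feasibleTJ_eq_of_union_of_cliques (I := Option (Fin 2)) Sum.getLeft?
    (by rintro (u | u) (v | v) <;> simp [bookGraph])
    (a := Sum.inl 0) (b := Sum.inl 1) (by simp)

theorem feasibleTJ_compl_pathGraph_of_le {n : ℕ} (h3 : 3 ≤ n) (h5 : n ≤ 5) :
    feasibleTJ (SimpleGraph.pathGraph n)ᶜ = {k | 2 ≤ k} := by
  interval_cases n
  · exact feasibleTJ_eq_of_edges (W := Fin 5) ![{0, 1}, {3, 4}, {1, 2}] (by decide) (by decide)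
      (by simp only [SimpleGraph.compl_adj, SimpleGraph.pathGraph_adj]; decide) (by decide)
      (a := 0) (b := 1) (by decide) (by simp [SimpleGraph.pathGraph_adj])
  · exact feasibleTJ_eq_of_edges (W := Fin 5) ![{1, 2}, {3, 4}, {0, 1}, {2, 3}] (by decide)
      (by decide) (by simp only [SimpleGraph.compl_adj, SimpleGraph.pathGraph_adj]; decide)
      (by decide) (a := 0) (b := 1) (by decide) (by simp [SimpleGraph.pathGraph_adj])
  -- A 4-cycle with a pendant edge.
  · exact feasibleTJ_eq_of_edges (W := Fin 5) ![{0, 1}, {2, 3}, {0, 4}, {1, 2}, {3, 0}]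
      (by decide) (by decide)
      (by simp only [SimpleGraph.compl_adj, SimpleGraph.pathGraph_adj]; decide)
      (by decide) (a := 0) (b := 1) (by decide) (by simp [SimpleGraph.pathGraph_adj])

theorem feasibleTJ_compl_pathGraph_eq_empty {n : ℕ} (hn : 6 ≤ n) :
    feasibleTJ (SimpleGraph.pathGraph n)ᶜ = ∅ := by
  -- In the complement, 3, 4, 5 induce only the edge between 3 and 5.
  apply feasibleTJ_eq_empty (a := ⟨0, by omega⟩) (b := ⟨1, by omega⟩) (x := ⟨3, by omega⟩)
    (y := ⟨4, by omega⟩) (z := ⟨5, by omega⟩) <;> simp [SimpleGraph.pathGraph_adj]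

theorem feasibleTJ_compl_cycleGraph_of_le {n : ℕ} (h4 : 4 ≤ n) (h6 : n ≤ 6) :
    feasibleTJ (SimpleGraph.cycleGraph n)ᶜ = {k | 2 ≤ k} := by
  interval_cases n
  · exact feasibleTJ_eq_of_edges (W := Fin 6) ![{0, 1}, {3, 4}, {1, 2}, {4, 5}] (by decide)
      (by decide) (by decide) (by decide) (a := 0) (b := 1) (by decide) (by decide)
  · exact feasibleTJ_eq_of_edges (W := Fin 5) ![{0, 1}, {2, 3}, {4, 0}, {1, 2}, {3, 4}]
      (by decide) (by decide) (by decide) (by decide) (a := 0) (b := 1) (by decide) (by decide)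
  -- The complement of `C_6` is the prism, the line graph of `K_{2,3}`.
  · exact feasibleTJ_eq_of_edges (W := Fin 5) ![{0, 2}, {1, 3}, {0, 4}, {1, 2}, {0, 3}, {1, 4}]
      (by decide) (by decide) (by decide) (by decide) (a := 0) (b := 1) (by decide) (by decide)

theorem feasibleTJ_compl_cycleGraph_eq_empty {n : ℕ} (hn : 7 ≤ n) :
    feasibleTJ (SimpleGraph.cycleGraph n)ᶜ = ∅ := by
  obtain ⟨m, rfl⟩ := Nat.exists_eq_add_of_le' hn
  -- With at least 7 vertices, no edge among 0, ..., 5 wraps around.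
  have hadj : ∀ u v : Fin (m + 7), u.1 ≤ 5 → v.1 ≤ 5 →
      ((SimpleGraph.cycleGraph (m + 7)).Adj u v ↔ u.1 = v.1 + 1 ∨ v.1 = u.1 + 1) := by
    intro u v hu hv
    rw [SimpleGraph.cycleGraph_adj (n := m + 5), sub_eq_iff_eq_add, sub_eq_iff_eq_add,
      Fin.ext_iff, Fin.ext_iff, Fin.val_add, Fin.val_add, Fin.val_one,
      Nat.mod_eq_of_lt (by omega), Nat.mod_eq_of_lt (by omega)]
    omega
  apply feasibleTJ_eq_empty (a := ⟨0, by omega⟩) (b := ⟨1, by omega⟩) (x := ⟨3, by omega⟩)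
    (y := ⟨4, by omega⟩) (z := ⟨5, by omega⟩) <;>
    first
    | (rw [ne_eq, Fin.ext_iff]; norm_num)
    | (simp only [SimpleGraph.compl_adj, ne_eq, Fin.ext_iff]
       repeat rw [hadj _ _ (by norm_num) (by norm_num)]
       norm_num)

instance (p : ℕ) : DecidableRel (friendshipGraph p).Adj := fun x y =>
  inferInstanceAs (Decidable (x ≠ y ∧ (x = none ∨ y = none ∨ x.map Prod.fst = y.map Prod.fst)))

theorem feasibleTJ_compl_friendshipGraph_of_le {p : ℕ} (h1 : 1 ≤ p) (h2 : p ≤ 2) :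
    feasibleTJ (friendshipGraph p)ᶜ = {k | 2 ≤ k} := by
  interval_cases p
  · exact feasibleTJ_eq_of_union_of_cliques id (by decide) (a := none) (b := some (0, 0)) (by simp)
  · exact feasibleTJ_eq_of_edges (W := Fin 6)
      (fun x => x.elim {4, 5} fun y => ![![{0, 1}, {2, 3}], ![{1, 2}, {3, 0}]] y.1 y.2)
      (by decide) (by decide) (by decide) (by decide)
      (a := none) (b := some (0, 0)) (by simp) (by decide)

/-- The complement is the octahedron plus an isolated vertex, the line graph of `K_4` plus a
disjoint edge. Antipodal octahedron vertices are joined to all four others, which bounds `k`. -/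
theorem feasibleTJ_compl_friendshipGraph_three : feasibleTJ (friendshipGraph 3)ᶜ = {2} := by
  ext k
  rw [Set.mem_singleton_iff]
  constructor
  · intro hk
    refine le_antisymm ?_ (two_le_of_mem_feasibleTJ hk (u := none) (v := some (0, 0))
      (by simp) (by decide))
    exact le_two_of_mem_feasibleTJ hk (a := some (0, 0)) (b := some (0, 1)) (x := some (1, 0))
      (y := some (2, 0)) (by decide) (by decide) (by decide) (by decide) (by decide) (by decide)
      (by decide) (by decide)
  · rintro rfl
    exact mem_feasibleTJ_of_edges (W := Fin 6)
      (fun x => x.elim {4, 5} fun y =>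
        ![![{0, 1}, {2, 3}], ![{1, 2}, {3, 0}], ![{0, 2}, {1, 3}]] y.1 y.2)
      (by decide) (by decide) (by decide) le_rfl (fun h => absurd h (lt_irrefl 2))

theorem feasibleTJ_compl_friendshipGraph_eq_empty {p : ℕ} (hp : 4 ≤ p) :
    feasibleTJ (friendshipGraph p)ᶜ = ∅ := by
  -- The three common neighbours come from different triangles of `F_p`, so they form a triangle in
  -- the complement.
  apply feasibleTJ_eq_empty (a := some (⟨0, by omega⟩, 0)) (b := some (⟨0, by omega⟩, 1))
    (x := some (⟨1, by omega⟩, 0)) (y := some (⟨2, by omega⟩, 0))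
    (z := some (⟨3, by omega⟩, 0)) <;> simp [friendshipGraph]

theorem mainTheorem6 :
    (∀ n : ℕ, 2 ≤ n → feasibleTJ (SimpleGraph.completeGraph (Fin n))ᶜ = {k : ℕ | 2 ≤ k}) ∧
    (∀ n : ℕ, 1 ≤ n →
      feasibleTJ (completeBipartiteGraph (Fin 1) (Fin n))ᶜ = {k : ℕ | 2 ≤ k}) ∧
    (∀ m n : ℕ, 2 ≤ m → m ≤ n →
      feasibleTJ (completeBipartiteGraph (Fin m) (Fin n))ᶜ = {k : ℕ | 2 ≤ k}) ∧
    (∀ p : ℕ, 1 ≤ p → feasibleTJ (bookGraph p)ᶜ = {k : ℕ | 2 ≤ k}) ∧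
    ((∀ n : ℕ, 3 ≤ n → n ≤ 5 →
        feasibleTJ (SimpleGraph.pathGraph n)ᶜ = {k : ℕ | 2 ≤ k}) ∧
      (∀ n : ℕ, 6 ≤ n → feasibleTJ (SimpleGraph.pathGraph n)ᶜ = ∅)) ∧
    ((∀ n : ℕ, 4 ≤ n → n ≤ 6 →
        feasibleTJ (SimpleGraph.cycleGraph n)ᶜ = {k : ℕ | 2 ≤ k}) ∧
      (∀ n : ℕ, 7 ≤ n → feasibleTJ (SimpleGraph.cycleGraph n)ᶜ = ∅)) ∧
    ((∀ p : ℕ, 1 ≤ p → p ≤ 2 →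
        feasibleTJ (friendshipGraph p)ᶜ = {k : ℕ | 2 ≤ k}) ∧
      feasibleTJ (friendshipGraph 3)ᶜ = {2} ∧
      (∀ p : ℕ, 4 ≤ p → feasibleTJ (friendshipGraph p)ᶜ = ∅)) :=
  ⟨fun _ hn => feasibleTJ_compl_completeGraph hn,
    fun _ hn => feasibleTJ_compl_completeBipartiteGraph le_rfl hn,
    fun _ _ hm hmn => feasibleTJ_compl_completeBipartiteGraph (by omega) (by omega),
    fun p _ => feasibleTJ_compl_bookGraph p,
    ⟨fun _ h3 h5 => feasibleTJ_compl_pathGraph_of_le h3 h5,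
      fun _ hn => feasibleTJ_compl_pathGraph_eq_empty hn⟩,
    ⟨fun _ h4 h6 => feasibleTJ_compl_cycleGraph_of_le h4 h6,
      fun _ hn => feasibleTJ_compl_cycleGraph_eq_empty hn⟩,
    fun _ h1 h2 => feasibleTJ_compl_friendshipGraph_of_le h1 h2,
    feasibleTJ_compl_friendshipGraph_three,
    fun _ hp => feasibleTJ_compl_friendshipGraph_eq_empty hp⟩
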